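/- **Model.** A network is a simple undirected graph on $n$ nodes, with distinct identifiers from a namespace $[N]$, $N\ge n$ (for instance $N$ polynomial in $n$). Each node initially knows its own identifier and the identifiers of its neighbours ($KT_1$). In $\mathrm{CONGEST}(B)$, in each synchronous round every node sends a $B$-bit message to each of its neighbours (possibly different messages to different neighbours); local computation is unrestricted, and an algorithm may depend on $n,\Delta,k,N$. In the $k$-cycle membership problem every node has to output whether it is part of a $k$-cycle. An *optimal-round* algorithm is one that completes within $\lfloor (k-1)/2\rfloor$ rounds. A deterministic algorithm solves the problem for $(n,\Delta)$ if on all $n$-node graphs of maximum degree $\Delta$ and all assignments of distinct identifiers all nodes output correctly; a randomized algorithm (private or shared randomness) solves it with high probability if, for some constant $a\ge 1$, on each such input all nodes output correctly with probability at least $1-n^{-a}$. **Theorem.** For $k\ge 4$ put $e_k=\lfloor\frac{k-4}{2}\rfloor+1$ (so $e_k=\frac{k-4}{2}+1$ for even $k$). For all constants $0<\varepsilon<1$, $C>0$ and $M$ there are $c>0$ and $n_0$, depending only on $\varepsilon, C, M$, such that the following holds for all integers $n\ge n_0$, $N\ge n$, $\Delta\ge 2$ and $k\ge 4$ with $$k\le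 M\Delta\qquad\text{and}\qquad (\Delta-1)^{e_k}\le C\,n^{1-\varepsilon}.$$ 1. If a deterministic optimal-round algorithm in $\mathrm{CONGEST}(B)$ solves $k$-cycle membership for $(n,\Delta)$, then $B\ge c\,\Delta^{e_k}\log n$. 2. If a randomized optimal-round algorithm in $\mathrm{CONGEST}(B)$ solves $k$-cycle membership for $(n,\Delta)$ with high probability, then $B\ge c\,\Delta^{e_k}$. In particular, for every fixed $k\ge4$ (take $M=k$), if $(\Delta-1)^{e_k}=O(n^{1-\varepsilon})$, then deterministic optimal-round algorithms need $B=\Omega(\Delta^{e_k}\log n)$ and randomized ones that succeed with high probability need $B=\Omega(\Delta^{e_k})$. -/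

import Mathlib

open MeasureTheory

noncomputable section

namespace Congest

/-- A `B`-bit message. -/
abbrev Msg (B : ℕ) : Type := Fin B → Bool

/-- A deterministic algorithm in the synchronous `CONGEST(B)` model with identifiers from a
namespace of size `N`, in the `KT₁` variant: initially a node knows its own identifier and the
set of identifiers of its neighbours. In each round it sends a `B`-bit message to each of its
neighbours (it may send different messages to different neighbours, addressed by identifier),
and then updates its state from the messages received. Local computation is unrestricted. -/
structure Algorithm (N B : ℕ) where
  /-- local states of a node -/
  State : Type
  /-- initial state, from the node's own identifier and those of its neighbours -/
  init : Fin N → Finset (Fin N) → State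
  /-- the message sent in the current state to the neighbour with the given identifier -/
  send : State → Fin N → Msg B
  /-- state update; the argument lists, for each identifier, the message received from the
  neighbour that has this identifier (`none` if there is no such neighbour) -/
  step : State → (Fin N → Option (Msg B)) → State
  /-- the decision of a node in a given state -/
  output : State → Bool

variable {n N B : ℕ}

/-- The identifiers of the neighbours of `v`. -/
def neighborIds (G : SimpleGraph (Fin n)) (ids : Fin n ↪ Fin N) (v : Fin n) : Finset (Fin N) :=
  open Classical in (G.neighborFinset v).map ids

/-- The messages which `v` receives in a round when `msg w i` is the message sent by `w` to its
neighbour with identifier `i`: the entry at `i` is the message from the neighbour of `v` with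
identifier `i`, if there is one. -/
def inbox (G : SimpleGraph (Fin n)) (ids : Fin n ↪ Fin N) (msg : Fin n → Fin N → Msg B)
    (v : Fin n) : Fin N → Option (Msg B) := fun i =>
  open Classical in
  if h : ∃ w, G.Adj v w ∧ ids w = i then some (msg h.choose (ids v)) else none

theorem inbox_of_adj (G : SimpleGraph (Fin n)) (ids : Fin n ↪ Fin N)
    (msg : Fin n → Fin N → Msg B) {v w : Fin n} (h : G.Adj v w) :
    inbox G ids msg v (ids w) = some (msg w (ids v)) := by
  have hex : ∃ w', G.Adj v w' ∧ ids w' = ids w := ⟨w, h, rfl⟩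
  have hw : hex.choose = w := ids.injective hex.choose_spec.2
  rw [inbox, dif_pos hex, hw]

/-- The state of each node after `t` rounds of the algorithm on the network `G` whose nodes have
the identifiers `ids`. -/
def Algorithm.run (A : Algorithm N B) (G : SimpleGraph (Fin n)) (ids : Fin n ↪ Fin N) :
    ℕ → Fin n → A.State
  | 0, v => A.init (ids v) (neighborIds G ids v)
  | t + 1, v =>
      A.step (A.run G ids t v) (inbox G ids (fun w i => A.send (A.run G ids t w) i) v)

/-- The output of node `v` after `r` rounds. -/
def Algorithm.result (A : Algorithm N B) (G : SimpleGraph (Fin n)) (ids : Fin n ↪ Fin N)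
    (r : ℕ) (v : Fin n) : Bool :=
  A.output (A.run G ids r v)

/-- A randomized `CONGEST(B)` algorithm: the random source `ω`, distributed according to the
probability measure `μ`, selects the deterministic algorithm that is executed. Private coins are
the case in which `ω` is an independent family of random strings, one for each identifier, and
each node uses the string of its own identifier only (`init` is given this identifier); shared
random strings are allowed as well. The outputs of the nodes are random variables. -/
structure RandomizedAlgorithm (N B : ℕ) where
  /-- outcomes of the random source -/
  Ω : Type
  [measurableSpace : MeasurableSpace Ω]
  /-- distribution of the random source -/
  μ : Measure Ω
  [isProbabilityMeasure : IsProbabilityMeasure μ]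
  /-- the deterministic algorithm for a fixed outcome of the random source -/
  alg : Ω → Algorithm N B
  measurableSet_result : ∀ {n : ℕ} (G : SimpleGraph (Fin n)) (ids : Fin n ↪ Fin N) (r : ℕ)
    (v : Fin n), MeasurableSet {ω | (alg ω).result G ids r v = true}

attribute [instance] RandomizedAlgorithm.measurableSpace RandomizedAlgorithm.isProbabilityMeasure

/-- The node `v` is part of a `k`-cycle of `G`. -/
def InCycle (G : SimpleGraph (Fin n)) (k : ℕ) (v : Fin n) : Prop :=
  ∃ p : G.Walk v v, p.IsCycle ∧ p.length = k

/-- `G` has maximum degree `Δ`. -/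
def HasMaxDegree (G : SimpleGraph (Fin n)) (Δ : ℕ) : Prop :=
  open Classical in G.maxDegree = Δ

/-- The number `⌊(k - 1) / 2⌋` of rounds of an optimal-round algorithm for `k`-cycle membership. -/
def optimalRounds (k : ℕ) : ℕ := (k - 1) / 2

/-- After `r` rounds on `G`, every node knows whether it is part of a `k`-cycle. -/
def Algorithm.CorrectOn (A : Algorithm N B) (r k : ℕ) (G : SimpleGraph (Fin n))
    (ids : Fin n ↪ Fin N) : Prop :=
  ∀ v : Fin n, A.result G ids r v = true ↔ InCycle G k v

/-- The deterministic algorithm `A` solves `k`-cycle membership within `r` rounds on all networks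
with `n` nodes and maximum degree `Δ`, for all assignments of distinct identifiers. -/
def Algorithm.Solves (A : Algorithm N B) (n Δ k r : ℕ) : Prop :=
  ∀ G : SimpleGraph (Fin n), HasMaxDegree G Δ → ∀ ids : Fin n ↪ Fin N, A.CorrectOn r k G ids

/-- The randomized algorithm `A` solves `k`-cycle membership within `r` rounds with high
probability, that is, with probability at least `1 - 1 / n ^ a` for some constant `a ≥ 1`, on
every network with `n` nodes and maximum degree `Δ` and every assignment of distinct
identifiers. -/
def RandomizedAlgorithm.SolvesWHP (A : RandomizedAlgorithm N B) (n Δ k r : ℕ) : Prop :=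
  ∃ a : ℝ, 1 ≤ a ∧ ∀ G : SimpleGraph (Fin n), HasMaxDegree G Δ → ∀ ids : Fin n ↪ Fin N,
    1 - 1 / (n : ℝ) ^ a ≤ A.μ.real {ω | (A.alg ω).CorrectOn r k G ids}

end Congest

end

noncomputable section

namespace Congest

variable {n N B : ℕ}

/-! ### Locality of synchronous algorithms -/

/-! With `b = Δ - 1`, `e = e_k` and `k = 2e + 2 + o`, the lower bound hides an index problem in a
network. From a central node, a path of length `e` leads to one leaf `i`. A `b`-ary tree of depth
`e`, also attached to the central node, has `b ^ e` leaf slots, and slot `j` is connected to one of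
`q` candidate leaves, chosen by `S`. The central node lies on a `k`-cycle exactly when `i` is a
chosen leaf (`inCycle_comap_network`).

An optimal-round algorithm runs for `e + o` rounds. In that time the choice can reach the central
node only through the tree root, and only in the last `o + 1 ≤ 2` messages, which are sent too early
to depend on `i` (`run_eq_of_transcript_eq`). These messages must therefore answer the question for
every `i`, so they determine `S` (`transcript_injOn`), and at most `4 ^ B` choices can be handled
correctly for all `i`.

For a randomized algorithm, a union bound over `i` makes each choice entirely correct with
probability at least `1/2`. Averaging gives `q ^ b ^ e ≤ 2 * 4 ^ B`. Since `q` can be a power of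
`n`, this yields `B = Ω(b ^ e log n)`. The deterministic case is a special case, and `k ≤ MΔ` makes
`b ^ e` and `Δ ^ e` comparable. -/

theorem inbox_congr {G G' : SimpleGraph (Fin n)} (ids : Fin n ↪ Fin N)
    {msg msg' : Fin n → Fin N → Msg B} {v : Fin n} (hadj : ∀ w, G.Adj v w ↔ G'.Adj v w)
    (hmsg : ∀ w, G.Adj v w → msg w (ids v) = msg' w (ids v)) :
    inbox G ids msg v = inbox G' ids msg' v := by
  funext i
  by_cases h : ∃ w, G.Adj v w ∧ ids w = i
  · obtain ⟨w, hw, rfl⟩ := h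
    rw [inbox_of_adj G ids msg hw, inbox_of_adj G' ids msg' ((hadj w).1 hw), hmsg w hw]
  · have h' : ¬ ∃ w, G'.Adj v w ∧ ids w = i := by simpa only [hadj] using h
    rw [inbox, inbox, dif_neg h, dif_neg h']

theorem neighborIds_congr {G G' : SimpleGraph (Fin n)} (ids : Fin n ↪ Fin N) {v : Fin n}
    (hadj : ∀ w, G.Adj v w ↔ G'.Adj v w) : neighborIds G ids v = neighborIds G' ids v := by
  classical
  ext i
  simp [neighborIds, hadj]

/-- If `δ` bounds from below the distance to the set of nodes at which two networks differ, then
the state of a node `v` after fewer than `δ v` rounds is the same in both. -/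
theorem Algorithm.run_congr (A : Algorithm N B) {G G' : SimpleGraph (Fin n)} (ids : Fin n ↪ Fin N)
    (δ : Fin n → ℕ) (hδ : ∀ v w, G.Adj v w → δ v ≤ δ w + 1)
    (hadj : ∀ v, 0 < δ v → ∀ w, G.Adj v w ↔ G'.Adj v w) (t : ℕ) (v : Fin n) (ht : t < δ v) :
    A.run G ids t v = A.run G' ids t v := by
  induction t generalizing v with
  | zero => rw [run, run, neighborIds_congr ids (hadj v ht)]
  | succ t ih =>
    rw [run, run, ih v (by omega), inbox_congr ids (hadj v (by omega))]
    intro w hw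
    rw [ih w (by have := hδ v w hw; omega)]

end Congest

/-! ### Cycles in graphs -/

namespace SimpleGraph

variable {V : Type*} {G : SimpleGraph V}

theorem exists_walk_of_forall_adj (f : ℕ → V) (m : ℕ) (hf : ∀ t < m, G.Adj (f t) (f (t + 1))) :
    ∃ p : G.Walk (f 0) (f m), p.length = m ∧ p.support = (List.range (m + 1)).map f := by
  induction m with
  | zero => exact ⟨.nil, rfl, rfl⟩
  | succ m ih =>
    obtain ⟨p, hl, hs⟩ := ih fun t ht => hf t (by omega)
    refine ⟨p.concat (hf m (by omega)), by simp [hl], ?_⟩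
    rw [Walk.support_concat, hs, List.range_succ (n := m + 1), List.map_append]
    simp

theorem exists_isCycle_of_forall_adj (f : ℕ → V) (m : ℕ) (hm : 2 ≤ m)
    (hf : ∀ t < m, G.Adj (f t) (f (t + 1))) (hadj : G.Adj (f m) (f 0))
    (hinj : Set.InjOn f {t | t ≤ m}) :
    ∃ p : G.Walk (f 0) (f 0), p.IsCycle ∧ p.length = m + 1 := by
  classical
  obtain ⟨p, hl, hs⟩ := exists_walk_of_forall_adj f m hf
  have hp : p.IsPath := by
    rw [Walk.isPath_def, hs]
    refine List.Nodup.map_on ?_ List.nodup_range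
    intro x hx y hy hxy
    rw [List.mem_range] at hx hy
    exact hinj (by simp; omega) (by simp; omega) hxy
  have hc : (Walk.cons hadj p).IsCycle := by
    rw [Walk.cons_isCycle_iff]
    refine ⟨hp, fun he => ?_⟩
    have := hp.length_eq_one_of_mem_edges (Sym2.eq_swap ▸ he)
    omega
  have hr := hc.rotate (show f 0 ∈ (Walk.cons hadj p).support by simp)
  exact ⟨_, hr, by simp [hl]⟩

/-- At a vertex of maximal rank on a cycle, both cycle edges would be outgoing, but the out-degree
is at most one. -/
theorem isAcyclic_of_rank (r : V → V → Prop) (hG : ∀ a b, G.Adj a b → r a b ∨ r b a)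
    (hr : ∀ a b c, r a b → r a c → b = c) (rank : V → ℕ) (hrank : ∀ a b, r a b → rank b < rank a) :
    G.IsAcyclic := by
  classical
  intro v p hp
  obtain ⟨u, hu, hmax⟩ := Finset.exists_max_image p.support.toFinset rank ⟨v, by simp⟩
  rw [List.mem_toFinset] at hu
  have hq := hp.rotate hu
  have key : ∀ w ∈ (p.rotate u hu).support, G.Adj u w → r u w := by
    intro w hw h
    refine (hG u w h).resolve_right fun h' => ?_
    have := hmax w (by simpa using hw)
    have := hrank w u h'
    omega
  exact hq.snd_ne_penultimate (hr u _ _ (key _ (Walk.getVert_mem_support _ _) ((p.rotate u hu).adj_snd hq.not_nil))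
    (key _ (Walk.getVert_mem_support _ _) ((p.rotate u hu).adj_penultimate hq.not_nil).symm))

end SimpleGraph

namespace Congest

/-! ### The networks of the lower bound -/

/-- The nodes of the networks of the lower bound: a path from the central node `path 0`, a tree
that hangs below the central node, and leaves, each of them a path with one or two nodes. -/
inductive Node : Type
  | path (d : ℕ)
  | leaf (j y z : ℕ)
  | tree (d j : ℕ)
  deriving DecidableEq

/-- The arcs of the network that belongs to the set of leaves `{(j, S j)}` and the leaf `i`. The
path leads to the leaf `i`; the leaves in the set lead into the tree, which is `b`-ary and has
depth `e`, and from there to `path 0`. Every leaf consists of `o + 1` nodes. -/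
inductive Arc (e o b : ℕ) (S : ℕ → ℕ) (i : ℕ × ℕ) : Node → Node → Prop
  | path (d : ℕ) : d < e → Arc e o b S i (.path d) (.path (d + 1))
  | enter : Arc e o b S i (.path e) (.leaf i.1 i.2 0)
  | leaf (j y z : ℕ) : z < o → Arc e o b S i (.leaf j y z) (.leaf j y (z + 1))
  | exit (j : ℕ) : Arc e o b S i (.leaf j (S j) o) (.tree e (j / b))
  | tree (d j : ℕ) : 1 ≤ d → d < e → Arc e o b S i (.tree (d + 1) j) (.tree d (j / b))
  | root : Arc e o b S i (.tree 1 0) (.path 0)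

variable {e o b : ℕ} {S S' : ℕ → ℕ} {i i' : ℕ × ℕ}

theorem Arc.out_unique {x y z : Node} (h : Arc e o b S i x y)
    (h' : Arc e o b S i x z) : y = z := by
  cases h <;> cases h' <;> first | rfl | omega

/-- A label that tells the in-neighbours of a node apart. -/
def Node.label (b : ℕ) : Node → ℕ
  | .path _ => 0
  | .leaf j _ _ => j % b
  | .tree _ j => j % b

theorem Node.label_lt (hb : 1 ≤ b) (x : Node) : x.label b < b := by
  cases x <;> simp only [label] <;> first | omega | exact Nat.mod_lt _ hb

/-- Quotient and remainder by `b` recover the index. So in-degrees are at most `b`, and with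
`Arc.out_unique` all degrees are at most `b + 1`. -/
theorem Arc.in_unique {x y z : Node} (h : Arc e o b S i x z)
    (h' : Arc e o b S i y z) (hl : x.label b = y.label b) : x = y := by
  have key : ∀ {j j' : ℕ}, j / b = j' / b → j % b = j' % b → j = j' := fun {j j'} h₁ h₂ => by
    rw [← Nat.div_add_mod j b, ← Nat.div_add_mod j' b, h₁, h₂]
  generalize hz : z = w at h'
  cases h <;> cases h' <;> simp only [Node.path.injEq, Node.leaf.injEq, Node.tree.injEq,
    reduceCtorEq] at hz <;> simp only [Node.label] at hl <;>
    first
    | rfl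
    | omega
    | (obtain rfl := key hz.2 hl; first | rfl | (obtain rfl := hz.1; rfl))
    | (obtain ⟨h1, h2, h3⟩ := hz; subst h1 h2; congr; omega)
    | exact hz.2.2.elim
    | (congr 1; omega)

/-- The network whose arcs are given by `Arc`. -/
def network (e o b : ℕ) (S : ℕ → ℕ) (i : ℕ × ℕ) : SimpleGraph Node where
  Adj x y := x ≠ y ∧ (Arc e o b S i x y ∨ Arc e o b S i y x)
  symm := ⟨fun _ _ h => ⟨h.1.symm, h.2.symm⟩⟩
  loopless := ⟨fun _ h => h.1 rfl⟩

theorem Arc.ne {x y : Node} (h : Arc e o b S i x y) : x ≠ y := by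
  cases h <;> simp

theorem network_adj {x y : Node} :
    (network e o b S i).Adj x y ↔ Arc e o b S i x y ∨ Arc e o b S i y x :=
  ⟨fun h => h.2, fun h => ⟨h.elim Arc.ne fun h => h.ne.symm, h⟩⟩

/-- The network has no cycle if the leaf `i` is not in the set. -/
theorem isAcyclic_network (hi : S i.1 ≠ i.2) : (network e o b S i).IsAcyclic := by
  classical
  -- An unchosen leaf `i` is a dead end. It is ranked lowest, then come the path, the tree and all
  -- other leaves.
  refine SimpleGraph.isAcyclic_of_rank (Arc e o b S i) (fun a b h => network_adj.1 h)
    (fun _ _ _ h h' => h.out_unique h') (fun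
      | .path d => (e - d) + 1 + o
      | .leaf j y z => if j = i.1 ∧ y = i.2 then o - z else 2 * e + 2 + o + (o - z)
      | .tree d _ => e + 1 + o + d) ?_
  intro x y h
  cases h <;> dsimp only
  case path => omega
  case enter => simp
  case leaf => split_ifs <;> omega
  case exit j =>
    rw [if_neg (by rintro ⟨rfl, h⟩; exact hi h)]
    omega
  all_goals omega

/-! ### Distances to the input-dependent edges -/

/-- A lower bound for the distance to the nodes whose neighbourhood depends on the set. -/
def Node.distSet (e o : ℕ) : Node → ℕ
  | .path d => min (e + 1 + o - d) (e + d)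
  | .leaf _ _ z => o - z
  | .tree d _ => e - d

/-- A lower bound for the distance to the nodes whose neighbourhood depends on `i`. -/
def Node.distIndex (e o : ℕ) : Node → ℕ
  | .path d => e - d
  | .leaf _ _ z => z
  | .tree d _ => min (e + 1 + o - d) (e + d)

theorem distSet_le_succ {x y : Node} (he : 1 ≤ e) (ho : o ≤ 1) (h : (network e o b S i).Adj x y) :
    x.distSet e o ≤ y.distSet e o + 1 := by
  rcases network_adj.1 h with h | h <;> cases h <;> simp only [Node.distSet] <;> omega

theorem distIndex_le_succ {x y : Node} (he : 1 ≤ e) (ho : o ≤ 1) (h : (network e o b S i).Adj x y) :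
    x.distIndex e o ≤ y.distIndex e o + 1 := by
  rcases network_adj.1 h with h | h <;> cases h <;> simp only [Node.distIndex] <;> omega

/-- The set enters only through `exit` arcs, and both ends of such an arc have `distSet` zero. -/
theorem network_adj_congr_set {x : Node} (hx : 0 < x.distSet e o) (y : Node) :
    (network e o b S i).Adj x y ↔ (network e o b S' i).Adj x y := by
  have key : ∀ {S S' : ℕ → ℕ}, (network e o b S i).Adj x y → (network e o b S' i).Adj x y := by
    intro S S' h
    rw [network_adj] at h ⊢
    rcases h with h | h <;> cases h <;> simp only [Node.distSet] at hx
    all_goals first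
      | omega
      | exact .inl (.path _ ‹_›)
      | exact .inl .enter
      | exact .inl (.leaf _ _ _ ‹_›)
      | exact .inl (.tree _ _ ‹_› ‹_›)
      | exact .inl .root
      | exact .inr (.path _ ‹_›)
      | exact .inr .enter
      | exact .inr (.leaf _ _ _ ‹_›)
      | exact .inr (.tree _ _ ‹_› ‹_›)
      | exact .inr .root
  exact ⟨key, key⟩

/-- The index enters only through the `enter` arc, and both of its ends have `distIndex` zero. -/
theorem network_adj_congr_index {x : Node} (hx : 0 < x.distIndex e o) (y : Node) :
    (network e o b S i).Adj x y ↔ (network e o b S i').Adj x y := by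
  have key : ∀ {i i' : ℕ × ℕ}, (network e o b S i).Adj x y → (network e o b S i').Adj x y := by
    intro i i' h
    rw [network_adj] at h ⊢
    rcases h with h | h <;> cases h <;> simp only [Node.distIndex] at hx
    all_goals first
      | omega
      | exact .inl (.path _ ‹_›)
      | exact .inl (.exit _)
      | exact .inl (.leaf _ _ _ ‹_›)
      | exact .inl (.tree _ _ ‹_› ‹_›)
      | exact .inl .root
      | exact .inr (.path _ ‹_›)
      | exact .inr (.exit _)
      | exact .inr (.leaf _ _ _ ‹_›)
      | exact .inr (.tree _ _ ‹_› ‹_›)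
      | exact .inr .root
  exact ⟨key, key⟩

/-- The neighbours of the central node. -/
theorem network_adj_zero {x : Node} (he : 1 ≤ e) :
    (network e o b S i).Adj (.path 0) x ↔ x = .path 1 ∨ x = .tree 1 0 := by
  rw [network_adj]
  constructor
  · rintro (h | h) <;> cases h <;> first | omega | simp
  · rintro (rfl | rfl)
    · exact .inl (.path 0 he)
    · exact .inr .root

/-! ### The core nodes and the `k`-cycle -/

/-- The nodes that are needed if the leaves are the elements of `s × q`. -/
def coreNodes (e o s q : ℕ) : Finset Node :=
  (Finset.range (e + 1)).image .path ∪
    (((Finset.range s ×ˢ Finset.range q) ×ˢ Finset.range (o + 1)).image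
      (fun p => .leaf p.1.1 p.1.2 p.2) ∪
    (Finset.Icc 1 e ×ˢ Finset.range s).image fun p => .tree p.1 p.2)

theorem card_coreNodes_le (e o s q : ℕ) :
    (coreNodes e o s q).card ≤ (e + 1) + (s * q * (o + 1) + e * s) := by
  refine (Finset.card_union_le _ _).trans (add_le_add (Finset.card_image_le.trans (by simp)) ?_)
  exact (Finset.card_union_le _ _).trans (add_le_add (Finset.card_image_le.trans (by simp))
    (Finset.card_image_le.trans (by simp)))

theorem path_mem_coreNodes {s q d : ℕ} (hd : d ≤ e) : Node.path d ∈ coreNodes e o s q := by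
  simp [coreNodes]; omega

theorem leaf_mem_coreNodes {s q j y z : ℕ} (hj : j < s) (hy : y < q) (hz : z ≤ o) :
    Node.leaf j y z ∈ coreNodes e o s q := by
  simp [coreNodes]; omega

theorem tree_mem_coreNodes {s q d j : ℕ} (hd : 1 ≤ d) (hd' : d ≤ e) (hj : j < s) :
    Node.tree d j ∈ coreNodes e o s q := by
  simp [coreNodes]; omega

/-- The cycle through `path 0` and the leaf `i`. -/
def cycleNode (e o b : ℕ) (i : ℕ × ℕ) (t : ℕ) : Node :=
  if t ≤ e then .path t
  else if t ≤ e + 1 + o then .leaf i.1 i.2 (t - (e + 1))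
  else .tree (2 * e + 2 + o - t) (i.1 / b ^ (t - (e + 1 + o)))

theorem cycleNode_injOn : Set.InjOn (cycleNode e o b i) {t | t ≤ 2 * e + 1 + o} := by
  intro t ht u hu h
  simp only [Set.mem_ofPred_eq] at ht hu
  simp only [cycleNode] at h
  split_ifs at h <;> simp at h <;> omega

theorem cycleNode_mem {s q t : ℕ} (h₁ : i.1 < s) (h₂ : i.2 < q) (ht : t ≤ 2 * e + 1 + o) :
    cycleNode e o b i t ∈ coreNodes e o s q := by
  simp only [cycleNode]
  split_ifs
  · exact path_mem_coreNodes ‹_›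
  · exact leaf_mem_coreNodes h₁ h₂ (by omega)
  · exact tree_mem_coreNodes (by omega) (by omega) ((Nat.div_le_self _ _).trans_lt h₁)

theorem arc_cycleNode (hS : S i.1 = i.2) {t : ℕ} (ht : t < 2 * e + 1 + o) :
    Arc e o b S i (cycleNode e o b i t) (cycleNode e o b i (t + 1)) := by
  simp only [cycleNode]
  split_ifs with h₁ h₂ h₃ h₄ h₅ h₆
  · exact .path t h₂
  · obtain rfl : t = e := by omega
    simpa using Arc.enter
  · omega
  · omega
  · rw [show t + 1 - (e + 1) = t - (e + 1) + 1 by omega]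
    exact .leaf _ _ _ (by omega)
  · obtain rfl : t = e + 1 + o := by omega
    have := Arc.exit (e := e) (o := o) (b := b) (S := S) (i := i) i.1
    rw [hS] at this
    convert this using 2
    · omega
    · omega
    · simp
  · omega
  · omega
  · have := Arc.tree (e := e) (o := o) (b := b) (S := S) (i := i) (2 * e + 2 + o - (t + 1))
      (i.1 / b ^ (t - (e + 1 + o))) (by omega) (by omega)
    rw [Nat.div_div_eq_div_mul, ← pow_succ] at this
    convert this using 3
    · omega
    · congr 1; omega

theorem arc_cycleNode_last (he : 1 ≤ e) (hi : i.1 < b ^ e) :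
    Arc e o b S i (cycleNode e o b i (2 * e + 1 + o)) (cycleNode e o b i 0) := by
  have : cycleNode e o b i (2 * e + 1 + o) = .tree 1 0 := by
    simp only [cycleNode]
    rw [if_neg (by omega), if_neg (by omega), show 2 * e + 1 + o - (e + 1 + o) = e by omega,
      Nat.div_eq_of_lt hi]
    congr 1; omega
  rw [this]
  simpa [cycleNode] using Arc.root

/-! ### Realization on `n` nodes -/

variable {n N B s q : ℕ}

/-- The padding nodes are arbitrary. They do no harm, because the degree bound and acyclicity hold
in the whole infinite network. -/
theorem exists_embedding_coreNodes (h : (coreNodes e o s q).card ≤ n) :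
    ∃ c : Fin n → Node, Function.Injective c ∧ ∀ x ∈ coreNodes e o s q, ∃ v, c v = x := by
  have : Infinite Node := Infinite.of_injective Node.path fun _ _ h => by simpa using h
  obtain ⟨P, hP, hcard⟩ := Infinite.exists_superset_card_eq (coreNodes e o s q) n h
  let φ := P.equivFinOfCardEq hcard
  refine ⟨fun v => (φ.symm v : Node), Subtype.val_injective.comp φ.symm.injective, fun x hx => ?_⟩
  exact ⟨φ ⟨x, hP hx⟩, by simp⟩

theorem hasMaxDegree_comap_network {c : Fin n → Node} (hc : Function.Injective c)
    (hcore : ∀ x ∈ coreNodes e o (b ^ e) q, ∃ v, c v = x) (he : 1 ≤ e) (hb : 1 ≤ b)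
    (hS : ∀ j < b ^ e, S j < q) : HasMaxDegree ((network e o b S i).comap c) (b + 1) := by
  classical
  have hpos : 0 < b ^ e := pow_pos hb e
  unfold HasMaxDegree
  apply le_antisymm
  · refine SimpleGraph.maxDegree_le_of_forall_degree_le _ _ fun v => ?_
    rw [← SimpleGraph.card_neighborFinset_eq_degree]
    let P : Fin n → Prop := fun w => Arc e o b S i (c w) (c v)
    rw [← Finset.card_filter_add_card_filter_not P]
    refine add_le_add ?_ ?_
    · rw [← Finset.card_range b]
      refine Finset.card_le_card_of_injOn (fun w => (c w).label b) (fun w _ => ?_) ?_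
      · simpa using Node.label_lt hb (c w)
      · intro w hw w' hw' h
        simp only [Finset.coe_filter, Set.mem_ofPred_eq] at hw hw'
        exact hc (Arc.in_unique hw.2 hw'.2 h)
    · rw [Finset.card_le_one]
      intro w hw w' hw'
      simp only [Finset.mem_filter, SimpleGraph.mem_neighborFinset, SimpleGraph.comap_adj,
        network_adj] at hw hw'
      exact hc ((hw.1.resolve_right hw.2).out_unique (hw'.1.resolve_right hw'.2))
  -- Degree `b + 1` is attained here: `b` chosen leaves and the parent `u`, which is `path 0` if `e
  -- = 1`.
  · obtain ⟨v, hv⟩ := hcore (.tree e 0) (tree_mem_coreNodes he le_rfl hpos)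
    refine le_trans ?_ (SimpleGraph.degree_le_maxDegree _ v)
    obtain ⟨u, hu, hu'⟩ : ∃ u, Arc e o b S i (c v) (c u) ∧ ∀ j y z, c u ≠ .leaf j y z := by
      rw [hv]
      obtain ⟨d, rfl⟩ : ∃ d, e = d + 1 := ⟨e - 1, by omega⟩
      rcases Nat.eq_zero_or_pos d with rfl | hd
      · obtain ⟨u, hu⟩ := hcore (.path 0) (path_mem_coreNodes (Nat.zero_le _))
        exact ⟨u, by rw [hu]; exact .root, by simp [hu]⟩
      · obtain ⟨u, hu⟩ := hcore (.tree d 0) (tree_mem_coreNodes hd (Nat.le_succ d) hpos)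
        refine ⟨u, ?_, by simp [hu]⟩
        rw [hu]
        simpa using Arc.tree (e := d + 1) (o := o) (b := b) (S := S) (i := i) d 0 hd d.lt_succ_self
    have hbs : b ≤ b ^ e := Nat.le_self_pow (by omega) b
    have hleaf : ∀ a : ℕ, ∃ w, a < b → c w = .leaf a (S a) o := fun a => by
      by_cases ha : a < b
      · obtain ⟨w, hw⟩ := hcore _ (leaf_mem_coreNodes (lt_of_lt_of_le ha hbs)
          (hS a (lt_of_lt_of_le ha hbs)) (le_refl o))
        exact ⟨w, fun _ => hw⟩
      · exact ⟨v, fun h => absurd h ha⟩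
    choose f hf using hleaf
    rw [← SimpleGraph.card_neighborFinset_eq_degree, ← Finset.card_range (b + 1)]
    refine Finset.card_le_card_of_injOn (fun a => if a < b then f a else u) ?_ ?_
    · intro a _
      simp only [Finset.mem_coe, SimpleGraph.mem_neighborFinset, SimpleGraph.comap_adj, network_adj]
      split_ifs with ha
      · right
        rw [hf a ha, hv]
        have := Arc.exit (e := e) (o := o) (b := b) (S := S) (i := i) a
        rwa [Nat.div_eq_of_lt ha] at this
      · exact .inl hu
    · intro a ha a' ha' h
      simp only [Finset.coe_range, Set.mem_Iio] at ha ha'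
      dsimp only at h
      split_ifs at h with h₁ h₂ h₂
      · have := congrArg c h
        rw [hf a h₁, hf a' h₂] at this
        simpa using (Node.leaf.inj this).1
      · exact absurd (h ▸ hf a h₁) (hu' _ _ _)
      · exact absurd (h ▸ hf a' h₂) (hu' _ _ _)
      · omega

theorem inCycle_comap_network {c : Fin n → Node} (hc : Function.Injective c)
    (hcore : ∀ x ∈ coreNodes e o (b ^ e) q, ∃ v, c v = x) (he : 1 ≤ e)
    (h₁ : i.1 < b ^ e) (h₂ : i.2 < q) {v : Fin n} (hv : c v = .path 0) :
    InCycle ((network e o b S i).comap c) (2 * e + 2 + o) v ↔ S i.1 = i.2 := by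
  constructor
  · rintro ⟨p, hp, -⟩
    by_contra h
    exact (isAcyclic_network h).comap ⟨c, id⟩ hc p hp
  · intro h
    have hex : ∀ t, ∃ w, t ≤ 2 * e + 1 + o → c w = cycleNode e o b i t := fun t => by
      by_cases ht : t ≤ 2 * e + 1 + o
      · obtain ⟨w, hw⟩ := hcore _ (cycleNode_mem h₁ h₂ ht)
        exact ⟨w, fun _ => hw⟩
      · exact ⟨v, fun h => absurd h ht⟩
    choose f hf using hex
    obtain rfl : f 0 = v := hc (by rw [hf 0 (Nat.zero_le _), hv]; simp [cycleNode])
    rw [show 2 * e + 2 + o = 2 * e + 1 + o + 1 by omega]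
    refine SimpleGraph.exists_isCycle_of_forall_adj f (2 * e + 1 + o) (by omega) ?_ ?_ ?_
    · intro t ht
      rw [SimpleGraph.comap_adj, network_adj, hf t ht.le, hf (t + 1) ht]
      exact .inl (arc_cycleNode h ht)
    · rw [SimpleGraph.comap_adj, network_adj, hf _ le_rfl, hf 0 (Nat.zero_le _)]
      exact .inl (arc_cycleNode_last he h₁)
    · intro t ht t' ht' h
      exact cycleNode_injOn ht ht' (by rw [← hf t ht, ← hf t' ht', h])

/-! ### What the central node can learn -/

section Locality

variable {c : Fin n → Node} (A : Algorithm N B) (ids : Fin n ↪ Fin N)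

theorem run_congr_set (he : 1 ≤ e) (ho : o ≤ 1) {t : ℕ} {v : Fin n}
    (ht : t < (c v).distSet e o) :
    A.run ((network e o b S i).comap c) ids t v = A.run ((network e o b S' i).comap c) ids t v :=
  A.run_congr ids (fun v => (c v).distSet e o) (fun _ _ h => distSet_le_succ he ho h)
    (fun _ hv _ => network_adj_congr_set hv _) t v ht

theorem run_congr_index (he : 1 ≤ e) (ho : o ≤ 1) {t : ℕ} {v : Fin n}
    (ht : t < (c v).distIndex e o) :
    A.run ((network e o b S i).comap c) ids t v = A.run ((network e o b S i').comap c) ids t v :=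
  A.run_congr ids (fun v => (c v).distIndex e o) (fun _ _ h => distIndex_le_succ he ho h)
    (fun _ hv _ => network_adj_congr_index hv _) t v ht

/-- The messages from the root `u` of the tree to the central node `v` in the rounds `e` and
`e + 1`. -/
def transcript (e o b : ℕ) (c : Fin n → Node) (A : Algorithm N B) (ids : Fin n ↪ Fin N)
    (u v : Fin n) (S : ℕ → ℕ) : Fin 2 → Msg B := fun a =>
  A.send (A.run ((network e o b S (0, 0)).comap c) ids (e - 1 + a) u) (ids v)

/-- The state of the central node depends on the set only through the transcript. -/
theorem run_eq_of_transcript_eq (hc : Function.Injective c) (he : 1 ≤ e) (ho : o ≤ 1)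
    {u v : Fin n} (hv : c v = .path 0) (hu : c u = .tree 1 0)
    (hT : transcript e o b c A ids u v S = transcript e o b c A ids u v S') (t : ℕ)
    (ht : t ≤ e + o) :
    A.run ((network e o b S i).comap c) ids t v =
      A.run ((network e o b S' i).comap c) ids t v := by
  induction t with
  | zero => exact run_congr_set A ids he ho (by rw [hv]; simp only [Node.distSet]; omega)
  | succ t ih =>
    rw [Algorithm.run, Algorithm.run, ih (by omega), inbox_congr ids]
    · intro w
      rw [SimpleGraph.comap_adj, SimpleGraph.comap_adj, hv, network_adj_zero he,
        network_adj_zero he]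
    · intro w hw
      rw [SimpleGraph.comap_adj, hv, network_adj_zero he] at hw
      rcases hw with hw | hw
      -- The neighbour on the path has `distSet` equal to `min (e + o) (e + 1)`, which exceeds `t`.
      · rw [run_congr_set A ids he ho]
        rw [hw]; simp only [Node.distSet]; omega
      · obtain rfl : w = u := hc (hw.trans hu.symm)
        by_cases hte : t < e - 1
        · rw [run_congr_set A ids he ho]
          rw [hw]; exact hte
        -- The root has not yet heard of `i`, so its message is the one recorded in the transcript
        -- for index `(0, 0)`.
        · have hlt : t < (c w).distIndex e o := by
            rw [hw]; simp only [Node.distIndex]; omega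
          have := congrFun hT ⟨t - (e - 1), by omega⟩
          simp only [transcript] at this
          rw [show e - 1 + (t - (e - 1)) = t by omega] at this
          rw [run_congr_index A ids he ho (i' := (0, 0)) hlt, this,
            run_congr_index A ids he ho (i := (0, 0)) (i' := i) hlt]

end Locality

/-! ### Counting transcripts -/

/-- The function on the natural numbers given by a choice of one leaf from each group. -/
def extendChoice (g : Fin s → Fin q) (j : ℕ) : ℕ := if h : j < s then g ⟨j, h⟩ else 0

/-- Choices of leaves for which an algorithm is correct with every leaf `i` have different
transcripts. -/
theorem transcript_injOn {c : Fin n → Node} (hc : Function.Injective c)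
    (hcore : ∀ x ∈ coreNodes e o (b ^ e) q, ∃ v, c v = x) (he : 1 ≤ e) (ho : o ≤ 1)
    (A : Algorithm N B) (ids : Fin n ↪ Fin N) {u v : Fin n} (hv : c v = .path 0)
    (hu : c u = .tree 1 0) :
    Set.InjOn (fun g : Fin (b ^ e) → Fin q => transcript e o b c A ids u v (extendChoice g))
      {g | ∀ i : Fin (b ^ e) × Fin q, A.CorrectOn (e + o) (2 * e + 2 + o)
        ((network e o b (extendChoice g) (i.1, i.2)).comap c) ids} := by
  intro g hg g' hg' h
  funext j
  -- Query the leaf that `g'` chooses in group `j`: the answer for `g'` is yes, hence also for `g`.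
  have h₁ := hg (j, g' j) v
  have h₂ := hg' (j, g' j) v
  rw [inCycle_comap_network hc hcore he j.2 (g' j).2 hv] at h₁ h₂
  have hrun := run_eq_of_transcript_eq A ids hc he ho (i := ((j : ℕ), ((g' j : Fin q) : ℕ)))
    hv hu h (e + o) le_rfl
  rw [Algorithm.result, hrun] at h₁
  have := h₁.1 (h₂.2 (by simp [extendChoice]))
  ext
  simpa [extendChoice] using this

theorem card_le_of_transcript {c : Fin n → Node} (hc : Function.Injective c)
    (hcore : ∀ x ∈ coreNodes e o (b ^ e) q, ∃ v, c v = x) (he : 1 ≤ e) (hb : 1 ≤ b) (ho : o ≤ 1)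
    (A : Algorithm N B) (ids : Fin n ↪ Fin N) (F : Finset (Fin (b ^ e) → Fin q))
    (hF : ∀ g ∈ F, ∀ i : Fin (b ^ e) × Fin q, A.CorrectOn (e + o) (2 * e + 2 + o)
        ((network e o b (extendChoice g) (i.1, i.2)).comap c) ids) : F.card ≤ 4 ^ B := by
  obtain ⟨v, hv⟩ := hcore (.path 0) (path_mem_coreNodes (Nat.zero_le _))
  obtain ⟨u, hu⟩ := hcore (.tree 1 0) (tree_mem_coreNodes le_rfl he (pow_pos hb e))
  have := Finset.card_le_card_of_injOn (t := (Finset.univ : Finset (Fin 2 → Msg B))) _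
    (fun g _ => Finset.mem_univ _)
    ((transcript_injOn hc hcore he ho A ids hv hu).mono (s₁ := (F : Set _)) fun g hg => hF g hg)
  refine this.trans (le_of_eq ?_)
  rw [show (4 : ℕ) = 2 ^ 2 by norm_num, ← pow_mul, mul_comm]
  simp [Msg, ← pow_mul]

/-! ### Randomized algorithms -/

theorem RandomizedAlgorithm.measurableSet_correctOn (A : RandomizedAlgorithm N B) (r k : ℕ)
    (G : SimpleGraph (Fin n)) (ids : Fin n ↪ Fin N) :
    MeasurableSet {ω | (A.alg ω).CorrectOn r k G ids} := by
  have : {ω | (A.alg ω).CorrectOn r k G ids} =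
      ⋂ v, {ω | (A.alg ω).result G ids r v = true ↔ InCycle G k v} := by
    ext; simp [Algorithm.CorrectOn]
  rw [this]
  refine MeasurableSet.iInter fun v => ?_
  by_cases h : InCycle G k v
  · simpa [h] using A.measurableSet_result G ids r v
  · simpa [h, Set.compl_def] using (A.measurableSet_result G ids r v).compl

/-- The sum of the probabilities of events of which at most `K` occur simultaneously is at most
`K`. -/
theorem sum_measureReal_le {Ω ι : Type*} [MeasurableSpace Ω] (μ : Measure Ω)
    [IsProbabilityMeasure μ] [Fintype ι] (E : ι → Set Ω) (hE : ∀ g, MeasurableSet (E g)) (K : ℕ)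
    (hK : ∀ ω, ∀ F : Finset ι, (∀ g ∈ F, ω ∈ E g) → F.card ≤ K) :
    ∑ g, μ.real (E g) ≤ K := by
  classical
  calc ∑ g, μ.real (E g) = ∑ g, ∫ ω, (E g).indicator (fun _ => (1 : ℝ)) ω ∂μ := by
        simp [integral_indicator_const, hE]
    _ = ∫ ω, ∑ g, (E g).indicator (fun _ => (1 : ℝ)) ω ∂μ :=
        (integral_finsetSum _ fun g _ => (integrable_const _).indicator (hE g)).symm
    _ ≤ ∫ _, (K : ℝ) ∂μ := by
        refine integral_mono (integrable_finsetSum _ fun g _ =>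
          (integrable_const _).indicator (hE g)) (integrable_const _) fun ω => ?_
        simp only [Set.indicator_apply, Finset.sum_boole]
        exact_mod_cast hK ω _ (by simp)
    _ = K := by simp

theorem RandomizedAlgorithm.pow_le_of_solvesWHP (A : RandomizedAlgorithm N B) (hn : n ≤ N)
    (hn₁ : 1 ≤ n) (he : 1 ≤ e) (hb : 1 ≤ b) (ho : o ≤ 1)
    (hA : A.SolvesWHP n (b + 1) (2 * e + 2 + o) (e + o))
    (hcard : (coreNodes e o (b ^ e) q).card ≤ n) (hq : 2 * (b ^ e * q) ≤ n) :
    q ^ b ^ e ≤ 2 * 4 ^ B := by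
  obtain ⟨a, ha, hA⟩ := hA
  obtain ⟨c, hc, hcore⟩ := exists_embedding_coreNodes hcard
  let ids : Fin n ↪ Fin N := Fin.castLEEmb hn
  let D : (Fin (b ^ e) → Fin q) → Fin (b ^ e) × Fin q → Set A.Ω := fun g i =>
    {ω | (A.alg ω).CorrectOn (e + o) (2 * e + 2 + o)
        ((network e o b (extendChoice g) (i.1, i.2)).comap c) ids}
  have hD : ∀ g i, MeasurableSet (D g i) := fun g i => A.measurableSet_correctOn _ _ _ _
  have hn₀ : (0 : ℝ) < n := by exact_mod_cast hn₁
  have hDμ : ∀ g i, A.μ.real (D g i)ᶜ ≤ 1 / n := by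
    intro g i
    rw [probReal_compl_eq_one_sub (hD g i)]
    have hdeg : HasMaxDegree ((network e o b (extendChoice g) (i.1, i.2)).comap c) (b + 1) :=
      hasMaxDegree_comap_network hc hcore he hb fun j hj => by simp [extendChoice, hj]
    have h₁ := hA _ hdeg ids
    have h₂ : 1 / (n : ℝ) ^ a ≤ 1 / n := by
      refine one_div_le_one_div_of_le hn₀ ?_
      simpa using Real.rpow_le_rpow_of_exponent_le (by exact_mod_cast hn₁ : (1 : ℝ) ≤ n) ha
    change 1 - A.μ.real {ω | _} ≤ _
    linarith
  -- Union bound: there are at most `n / 2` indices, each failing with probability at most `1 / n`.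
  have hE : ∀ g, 1 / 2 ≤ A.μ.real (⋂ i, D g i) := by
    intro g
    have h₁ : A.μ.real (⋂ i, D g i)ᶜ ≤ 1 / 2 := by
      rw [Set.compl_iInter]
      calc A.μ.real (⋃ i, (D g i)ᶜ) ≤ ∑ i, A.μ.real (D g i)ᶜ := measureReal_iUnion_fintype_le _
        _ ≤ ∑ _i : Fin (b ^ e) × Fin q, 1 / (n : ℝ) := Finset.sum_le_sum fun i _ => hDμ g i
        _ = ((b ^ e * q : ℕ) : ℝ) / n := by simp [div_eq_mul_inv]
        _ ≤ 1 / 2 := by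
          rw [div_le_div_iff₀ hn₀ two_pos]
          have : ((2 * (b ^ e * q) : ℕ) : ℝ) ≤ n := by exact_mod_cast hq
          push_cast at this ⊢
          linarith
    rw [probReal_compl_eq_one_sub (MeasurableSet.iInter (hD g))] at h₁
    linarith
  have hsum := sum_measureReal_le A.μ (fun g => ⋂ i, D g i) (fun g => MeasurableSet.iInter (hD g))
    (4 ^ B) fun ω F hF => card_le_of_transcript hc hcore he hb ho (A.alg ω) ids F
      fun g hg i => Set.mem_iInter.1 (hF g hg) i
  have h := (Finset.sum_le_sum fun g _ => hE g).trans hsum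
  simp only [Finset.sum_const, Finset.card_univ, Fintype.card_fun, Fintype.card_fin,
    nsmul_eq_mul] at h
  have : ((q ^ b ^ e : ℕ) : ℝ) ≤ (2 * 4 ^ B : ℕ) := by push_cast at h ⊢; linarith
  exact_mod_cast this

/-- A deterministic algorithm as a randomized one. -/
def Algorithm.toRandomized (A : Algorithm N B) : RandomizedAlgorithm N B where
  Ω := Unit
  μ := Measure.dirac ()
  alg := fun _ => A
  measurableSet_result := fun _ _ _ _ => MeasurableSet.of_discrete

theorem Algorithm.Solves.solvesWHP {A : Algorithm N B} {Δ k r : ℕ} (h : A.Solves n Δ k r) :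
    A.toRandomized.SolvesWHP n Δ k r := by
  refine ⟨1, le_rfl, fun G hG ids => ?_⟩
  have : {ω | (A.toRandomized.alg ω).CorrectOn r k G ids} = Set.univ :=
    Set.eq_univ_of_forall fun _ => h G hG ids
  rw [this, probReal_univ]
  have : (0 : ℝ) ≤ 1 / (n : ℝ) ^ (1 : ℝ) := by positivity
  linarith

/-! ### Choice of parameters and estimates -/

open Filter Asymptotics in
-- The first inequality makes room for the tree; the second survives rounding down in the definition
-- of `q`.
theorem exists_forall_log_le_rpow (ε C M : ℝ) (hε : 0 < ε) (hC : 0 < C) :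
    ∃ n₀ : ℕ, 3 ≤ n₀ ∧ ∀ n : ℕ, n₀ ≤ n →
      6 * C * (M + 2 * (Real.log C + Real.log n)) ≤ (n : ℝ) ^ ε ∧
      2 * (n : ℝ) ^ (ε / 2) + 1 ≤ (n : ℝ) ^ ε / (4 * C) := by
  have hconst' : ∀ η : ℝ, 0 < η → ∀ a : ℝ, (fun _ : ℝ => a) =o[atTop] fun x : ℝ => x ^ η :=
    fun η hη a => isLittleO_const_left.2 <| .inr <|
      tendsto_norm_atTop_atTop.comp (tendsto_rpow_atTop hη)
  have hconst := hconst' ε hε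
  have hhalf : (fun x : ℝ => x ^ (ε / 2)) =o[atTop] fun x : ℝ => x ^ ε := by
    refine ((hconst' (ε / 2) (half_pos hε) 1).mul_isBigO
      (isBigO_refl (fun x : ℝ => x ^ (ε / 2)) atTop)).congr' (.of_forall fun x => by simp) ?_
    filter_upwards [eventually_gt_atTop 0] with x hx
    rw [← Real.rpow_add hx, add_halves]
  have h₁ : (fun x : ℝ => 6 * C * (M + 2 * (Real.log C + Real.log x))) =o[atTop]
      fun x : ℝ => x ^ ε :=
    (((hconst M).add (((hconst (Real.log C)).add
      (isLittleO_log_rpow_atTop hε)).const_mul_left 2)).const_mul_left (6 * C))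
  have h₂ : (fun x : ℝ => 2 * x ^ (ε / 2) + 1) =o[atTop] fun x : ℝ => x ^ ε :=
    (hhalf.const_mul_left 2).add (hconst 1)
  have h₃ := h₁.bound one_pos
  have h₄ := h₂.bound (show (0 : ℝ) < 1 / (4 * C) by positivity)
  obtain ⟨n₀, hn₀⟩ := eventually_atTop.1
    (tendsto_natCast_atTop_atTop.eventually (h₃.and h₄))
  refine ⟨max n₀ 3, le_max_right _ _, fun n hn => ?_⟩
  obtain ⟨h, h'⟩ := hn₀ n (le_trans (le_max_left _ _) hn)
  have hpos : (0 : ℝ) ≤ (n : ℝ) ^ ε := by positivity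
  rw [Real.norm_of_nonneg hpos] at h h'
  refine ⟨by simpa using (le_abs_self _).trans h, ?_⟩
  have := (le_abs_self _).trans h'
  rwa [one_div_mul_eq_div] at this

/-- The parameters of the lower bound: the networks fit into `n` nodes, and the number `q` of
leaves in each group is polynomial in `n`. -/
theorem exists_groupSize {ε C M : ℝ} {n b e o : ℕ} (hε₀ : 0 < ε) (hC : 0 < C)
    (hn : 3 ≤ n) (he : 1 ≤ e) (hb : 1 ≤ b) (ho : o ≤ 1) (heM : b = 1 → (e : ℝ) ≤ M) (hM : 0 ≤ M)
    (hs : (b : ℝ) ^ e ≤ C * (n : ℝ) ^ (1 - ε))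
    (h₁ : 6 * C * (M + 2 * (Real.log C + Real.log n)) ≤ (n : ℝ) ^ ε)
    (h₂ : 2 * (n : ℝ) ^ (ε / 2) + 1 ≤ (n : ℝ) ^ ε / (4 * C)) :
    ∃ q : ℕ, (coreNodes e o (b ^ e) q).card ≤ n ∧ 2 * (b ^ e * q) ≤ n ∧
      2 * (n : ℝ) ^ (ε / 2) ≤ q := by
  have hn₁ : (1 : ℝ) ≤ n := by exact_mod_cast (by omega : 1 ≤ n)
  have hn₀ : (0 : ℝ) < n := by linarith
  have hs₁ : (1 : ℝ) ≤ (b : ℝ) ^ e := one_le_pow₀ (by exact_mod_cast hb)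
  have hsplit : (n : ℝ) ^ (1 - ε) * (n : ℝ) ^ ε = n := by
    rw [← Real.rpow_add hn₀]; simp
  have hlog : Real.log ((b : ℝ) ^ e) ≤ Real.log C + Real.log n := by
    rw [← Real.log_mul hC.ne' hn₀.ne']
    refine Real.log_le_log (by linarith) (hs.trans ?_)
    gcongr
    simpa using Real.rpow_le_rpow_of_exponent_le hn₁ (by linarith : 1 - ε ≤ 1)
  have hlog₀ : 0 ≤ Real.log ((b : ℝ) ^ e) := Real.log_nonneg hs₁
  -- For `b ≥ 2` the depth is logarithmic in `b ^ e`; for `b = 1` only `heM` bounds it.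
  have he' : (e : ℝ) ≤ M + 2 * (Real.log C + Real.log n) := by
    rcases Nat.eq_or_lt_of_le hb with h | h
    · linarith [heM h.symm]
    · have : (e : ℝ) * Real.log 2 ≤ Real.log ((b : ℝ) ^ e) := by
        rw [Real.log_pow]
        gcongr
        exact_mod_cast h
      have h2 := Real.log_two_gt_d9
      have : (e : ℝ) * (1 / 2) ≤ e * Real.log 2 := by gcongr; linarith
      linarith
  have hes : 6 * (e * b ^ e) ≤ n := by
    have : (6 * (e * b ^ e) : ℝ) ≤ n := by
      calc (6 * (e * b ^ e) : ℝ)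
          ≤ 6 * ((M + 2 * (Real.log C + Real.log n)) * (C * (n : ℝ) ^ (1 - ε))) := by
            gcongr
            exact e.cast_nonneg.trans he'
        _ = (n : ℝ) ^ (1 - ε) * (6 * C * (M + 2 * (Real.log C + Real.log n))) := by ring
        _ ≤ (n : ℝ) ^ (1 - ε) * (n : ℝ) ^ ε := by gcongr
        _ = n := hsplit
    exact_mod_cast this
  have hq : 4 * b ^ e * (n / (4 * b ^ e)) ≤ n := Nat.mul_div_le _ _
  -- The leaves, of at most two nodes each, fill at most `n / 2` nodes; path and tree need at most
  -- `3 * e * b ^ e ≤ n / 2`.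
  refine ⟨n / (4 * b ^ e), (card_coreNodes_le _ _ _ _).trans ?_, by nlinarith, ?_⟩
  · have hs₁' : 1 ≤ b ^ e := Nat.one_le_pow _ _ hb
    have h3 : e ≤ e * b ^ e := Nat.le_mul_of_pos_right _ hs₁'
    have h4 : b ^ e * (n / (4 * b ^ e)) * (o + 1) ≤ b ^ e * (n / (4 * b ^ e)) * 2 := by
      gcongr; omega
    nlinarith
  · have hlt : (n : ℝ) / (4 * b ^ e) < ((n / (4 * b ^ e) : ℕ) : ℝ) + 1 := by
      rw [div_lt_iff₀ (by positivity)]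
      have := Nat.lt_mul_div_succ n (show 0 < 4 * b ^ e by positivity)
      have : (n : ℝ) < ((4 * b ^ e * (n / (4 * b ^ e) + 1) : ℕ) : ℝ) := by exact_mod_cast this
      push_cast at this
      linarith
    have hge : (n : ℝ) ^ ε / (4 * C) ≤ (n : ℝ) / (4 * b ^ e) := by
      rw [div_le_div_iff₀ (by positivity) (by positivity)]
      calc (n : ℝ) ^ ε * (4 * b ^ e) ≤ (n : ℝ) ^ ε * (4 * (C * (n : ℝ) ^ (1 - ε))) := by gcongr
        _ = ((n : ℝ) ^ (1 - ε) * (n : ℝ) ^ ε) * (4 * C) := by ring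
        _ = n * (4 * C) := by rw [hsplit]
    linarith

theorem mul_log_le_of_pow_le {ε : ℝ} {n q s B : ℕ} (hn : 1 ≤ n) (hs : 1 ≤ s)
    (hq : 2 * (n : ℝ) ^ (ε / 2) ≤ q) (h : q ^ s ≤ 2 * 4 ^ B) :
    s * (ε / 4 * Real.log n) ≤ B := by
  have hn₀ : (0 : ℝ) < n := by exact_mod_cast hn
  have hqs : ((n : ℝ) ^ (ε / 2)) ^ s ≤ 4 ^ B := by
    have h₁ : (2 * (n : ℝ) ^ (ε / 2)) ^ s ≤ 2 * 4 ^ B :=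
      (pow_le_pow_left₀ (by positivity) hq s).trans (by exact_mod_cast h)
    -- The factor 2 in the bound on `q` pays for the factor 2 in front of `4 ^ B`.
    have h₂ : (2 : ℝ) ≤ 2 ^ s := by simpa using pow_le_pow_right₀ (one_le_two : (1 : ℝ) ≤ 2) hs
    rw [mul_pow] at h₁
    have h₃ : (0 : ℝ) ≤ ((n : ℝ) ^ (ε / 2)) ^ s := by positivity
    nlinarith
  have hlog := Real.log_le_log (by positivity) hqs
  rw [Real.log_pow, Real.log_pow, Real.log_rpow hn₀, show (4 : ℝ) = 2 ^ 2 by norm_num,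
    Real.log_pow] at hlog
  push_cast at hlog
  have h2 : (B : ℝ) * (2 * Real.log 2) ≤ B * (2 * 1) := by
    gcongr
    linarith [Real.log_two_lt_d9]
  linarith

/-- Since `(1 + 1/b) ^ e ≤ exp (e/b)`, replacing `Δ - 1` by `Δ` costs only a constant factor. -/
theorem succ_pow_le_exp_mul_pow {M : ℝ} {b e : ℕ} (hb : 1 ≤ b) (he : (e : ℝ) ≤ M * b) :
    ((b : ℝ) + 1) ^ e ≤ Real.exp M * (b : ℝ) ^ e := by
  have hb₀ : (0 : ℝ) < b := by exact_mod_cast hb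
  calc ((b : ℝ) + 1) ^ e = (1 / (b : ℝ) + 1) ^ e * (b : ℝ) ^ e := by
        rw [← mul_pow]; congr 1; field_simp; ring
    _ ≤ (Real.exp (1 / b)) ^ e * (b : ℝ) ^ e := by
        gcongr; exact Real.add_one_le_exp _
    _ ≤ Real.exp M * (b : ℝ) ^ e := by
        rw [← Real.exp_nat_mul]
        gcongr
        rw [mul_one_div, div_le_iff₀ hb₀]
        exact he

end Congest
end

theorem mainTheorem5 (ε C M : ℝ) (hε₀ : 0 < ε) (hε₁ : ε < 1) (hC : 0 < C) :
    ∃ c : ℝ, 0 < c ∧ ∃ n₀ : ℕ, ∀ n Δ k N : ℕ, n₀ ≤ n → n ≤ N → 2 ≤ Δ → 4 ≤ k →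
      (k : ℝ) ≤ M * Δ →
      ((Δ : ℝ) - 1) ^ ((k - 4) / 2 + 1) ≤ C * (n : ℝ) ^ (1 - ε) →
      (∀ (B : ℕ) (A : Congest.Algorithm N B),
        A.Solves n Δ k (Congest.optimalRounds k) →
          c * ((Δ : ℝ) ^ ((k - 4) / 2 + 1) * Real.log n) ≤ B) ∧
      (∀ (B : ℕ) (A : Congest.RandomizedAlgorithm N B),
        A.SolvesWHP n Δ k (Congest.optimalRounds k) →
          c * (Δ : ℝ) ^ ((k - 4) / 2 + 1) ≤ B) := by
  obtain ⟨n₀, hn₀, hlarge⟩ := Congest.exists_forall_log_le_rpow ε C |M| hε₀ hC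
  refine ⟨Real.exp (-|M|) * (ε / 4), by positivity, n₀, ?_⟩
  intro n Δ k N hn hN hΔ hk hkM hs
  obtain ⟨b, rfl⟩ : ∃ b, Δ = b + 1 := ⟨Δ - 1, by omega⟩
  obtain ⟨e, o, he, ho, rfl, hek⟩ : ∃ e o : ℕ, 1 ≤ e ∧ o ≤ 1 ∧ k = 2 * e + 2 + o ∧
      (k - 4) / 2 + 1 = e := ⟨(k - 4) / 2 + 1, k % 2, by omega, by omega, by omega, rfl⟩
  have hr : Congest.optimalRounds (2 * e + 2 + o) = e + o := by
    unfold Congest.optimalRounds; omega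
  rw [hek, hr]
  rw [hek] at hs
  push_cast at hs hkM ⊢
  rw [add_sub_cancel_right] at hs
  have hb : 1 ≤ b := by omega
  have hb₁ : (1 : ℝ) ≤ b := by exact_mod_cast hb
  have heM : (e : ℝ) ≤ |M| * b := by
    have : M * ((b : ℝ) + 1) ≤ |M| * (2 * b) :=
      mul_le_mul (le_abs_self M) (by linarith) (by positivity) (abs_nonneg M)
    have : (0 : ℝ) ≤ o := Nat.cast_nonneg o
    linarith
  obtain ⟨h₁, h₂⟩ := hlarge n hn
  obtain ⟨q, hcard, hq, hnq⟩ := Congest.exists_groupSize hε₀ hC (hn₀.trans hn) he hb ho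
    (fun h => by simpa [h] using heM) (abs_nonneg M) hs h₁ h₂
  have hlog : 1 ≤ Real.log n := by
    rw [Real.le_log_iff_exp_le (by exact_mod_cast (by omega : 0 < n))]
    have : (3 : ℝ) ≤ n := by exact_mod_cast hn₀.trans hn
    linarith [Real.exp_one_lt_d9]
  have key : ∀ (B : ℕ) (A : Congest.RandomizedAlgorithm N B),
      A.SolvesWHP n (b + 1) (2 * e + 2 + o) (e + o) →
        Real.exp (-|M|) * (ε / 4) * (((b : ℝ) + 1) ^ e * Real.log n) ≤ B := by
    intro B A hA
    have h := Congest.mul_log_le_of_pow_le (by omega) (Nat.one_le_pow _ _ hb) hnq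
      (A.pow_le_of_solvesWHP hN (by omega) he hb ho hA hcard hq)
    push_cast at h
    refine le_trans ?_ h
    have hpow := Congest.succ_pow_le_exp_mul_pow hb heM
    calc Real.exp (-|M|) * (ε / 4) * (((b : ℝ) + 1) ^ e * Real.log n)
        ≤ Real.exp (-|M|) * (ε / 4) * ((Real.exp |M| * (b : ℝ) ^ e) * Real.log n) := by gcongr
      _ = (Real.exp (-|M|) * Real.exp |M|) * ((b : ℝ) ^ e * (ε / 4 * Real.log n)) := by ring
      _ = (b : ℝ) ^ e * (ε / 4 * Real.log n) := by rw [← Real.exp_add]; simp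
  -- `key` has the factor `log n` even for randomized algorithms; the second claim drops it, using
  -- `log n ≥ 1`.
  refine ⟨fun B A hA => key B _ hA.solvesWHP, fun B A hA => le_trans ?_ (key B A hA)⟩
  gcongr
  exact le_mul_of_one_le_right (by positivity) hlog
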